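/- Let $G=(V,E)$ be a finite simple graph with $n=|V|$, let $(C_1,C_2,\dots)$ be a partial $k$-coloring of $G$ (pairwise disjoint stable sets, $C_i=\emptyset$ for $i>k$), let $U$ be the set of uncolored vertices, and for $v\in U$ let $F(v)\subseteq\{1,\dots,n\}$ be the set of colors not used on a neighbor of $v$. Let $k_0\ge 1$ with $k\le k_0\le n$ and $C=\{1,\dots,k_0\}$. Let $U=U^0\cup U^1\cup\dots\cup U^l$ be a disjoint decomposition in which $U^1,\dots,U^l$ are pairwise non-adjacent cliques. For $0\le j\le l$ let $F^j=\{f^j(i): i\in C\}$ be a copy of $C$, and put $F=\bigcup_{j=0}^l F^j$, $F^C=\bigcup_{j=1}^l F^j$. Consider the network with node set $U\cup F\cup C$ and arcs $v\to f^j(i)$ for $v\in U^j$, $i\in F(v)\cap C$, and $f^j(i)\to i$ for all $j$ and $i\in C$. Write $\delta^+(W),\delta^-(W)$ for the sets of out- and in-neighbors of a node set $W$, and $e(W_1,W_2)$ for the number of arcs from $W_1$ to $W_2$. The flow problem asks for real arc values $x\geq 0$ such that the total outflow of each $u\in U$ is $1$, flow is conserved at every node of $F$, the inflow of each $i\in C$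 lies between $\lfloor n/k_0\rfloor-|C_i|$ and $\lceil n/k_0\rceil-|C_i|$, and each arc has flow at most $1$, except that arcs leaving $F^0$ have flow at most $|U^0|$. For $R_+,R_-\subseteq U$, $S_+,S_-\subseteq F$, $T_+,T_-\subseteq C$ with $$\delta^+(R_+)\cap S_-=\delta^+(R_-)\cap S_+=\delta^+(S_+)\cap T_-=\delta^+(S_-)\cap T_+=\emptyset$$ the associated Hall inequality is $$\begin{aligned}|R_-|+\sum_{i\in T_-}\bigl(|C_i|-\lceil \tfrac n{k_0}\rceil\bigr)\le{}& |R_+|+\sum_{i\in T_+}\bigl(|C_i|-\lfloor \tfrac n{k_0}\rfloor\bigr)+e(R_-,F\setminus S_-)+e(U\setminus R_+,S_+)\\&+e(S_-\cap F^C,C\setminus T_-)+|U^0|\,e(S_-\cap F^0,C\setminus T_-)\\&+e(F^C\setminus S_+,T_+)+|U^0|\,e(F^0\setminus S_+,T_+).\end{aligned}$$ For $S_-\subseteq F$ put $\bar R(S_-)=\{v\in U:\delta^+(v)\subseteq S_-\}$. For $\emptyset\ne T_-\subseteq C$ call $S_-\subseteq F$ admissible for $T_-$ if $S_-\supseteq\delta^-(T_-)$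 and $S_-\cap F^0=\delta^-(T_-)\cap F^0$, and let the reduced condition of $(S_-,T_-)$ be $$|\bar R(S_-)|+\sum_{i\in T_-}\bigl(|C_i|-\lceil \tfrac n{k_0}\rceil\bigr)\le e(S_-\cap F^C,\,C\setminus T_-).\qquad(*)$$ Then the flow problem has a solution if and only if all Hall inequalities with $T_-=\emptyset$ hold and $(*)$ holds for every nonempty $T_-\subseteq C$ and every $S_-$ admissible for $T_-$. Moreover, for every nonempty $T_-\subseteq C$: 1. For all $R_-\subseteq U$ and $S_-\subseteq F$ there is an $S'_-$ admissible for $T_-$ such that the Hall inequality of $(\bar R(S'_-),S'_-,T_-)$ (with $R_+=S_+=T_+=\emptyset$) dominates that of $(R_-,S_-,T_-)$: its right-hand side minus its left-hand side is at most that of the latter. 2. If $S_-$ is admissible for $T_-$ and $R_-=\bar R(S_-)$, $R_+=S_+=T_+=\emptyset$, then the right-hand side of the Hall inequality equals $e(S_-\cap F^C,C\setminus T_-)$, so that the inequality is equivalent to $(*)$. 3. The Hall inequalities of $(R_-,S_-,T_-)$ with $R_+=S_+=T_+=\emptyset$ hold for all $R_-\subseteq U$, $S_-\subseteq F$ if and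 only if $(*)$ holds for all $S_-$ admissible for $T_-$. 4. $S_-=\delta^-(T_-)$ is admissible for $T_-$, and for it $(*)$ is equivalent to $$\bigl|\{v\in U: F(v)\cap C\subseteq T_-\}\bigr|\le\sum_{i\in T_-}\bigl(\lceil \tfrac n{k_0}\rceil-|C_i|\bigr);$$ in particular this inequality holds whenever the flow problem has a solution. -/

import Mathlib

namespace EquitableFlow

/-- A partial `k`-coloring of `G`: pairwise disjoint stable color classes `cls 0, …, cls (k-1)`
(colors are numbered from `0`), every later class being empty. -/
structure PartialColoring {V : Type*} (G : SimpleGraph V) (k : ℕ) where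
  cls : ℕ → Finset V
  disjoint : ∀ i j, i ≠ j → Disjoint (cls i) (cls j)
  stable : ∀ i, ∀ v ∈ cls i, ∀ w ∈ cls i, ¬ G.Adj v w
  empty : ∀ i, k ≤ i → cls i = ∅

section Colorings

variable {V : Type*} [Fintype V] {G : SimpleGraph V} {k : ℕ}

open scoped Classical in
/-- The set `U` of uncolored vertices. -/
noncomputable def PartialColoring.uncolored (c : PartialColoring G k) : Finset V :=
  {v | ∀ i, v ∉ c.cls i}

open scoped Classical in
/-- The forbidden colors `D(v)`: the colors of the colored neighbors of `v`. -/
noncomputable def PartialColoring.forbidden (c : PartialColoring G k) (v : V) : Finset ℕ :=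
  {i ∈ Finset.range (Fintype.card V) | ∃ w ∈ c.cls i, G.Adj w v}

/-- The free colors `F(v)`, among all `n = |V|` colors. -/
noncomputable def PartialColoring.free (c : PartialColoring G k) (v : V) : Finset ℕ :=
  Finset.range (Fintype.card V) \ c.forbidden v

/-- A decomposition of the uncolored vertices into pairwise non-adjacent cliques
`U^1, …, U^l` and a set `U^0` of remaining vertices. -/
structure MixedDecomposition (c : PartialColoring G k) (l : ℕ) where
  part : Fin (l + 1) → Finset V
  disjoint : ∀ i j, i ≠ j → Disjoint (part i) (part j)
  cover : ∀ v, v ∈ c.uncolored ↔ ∃ j, v ∈ part j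
  clique : ∀ j, j ≠ 0 → G.IsClique (part j : Set V)
  nonadjacent : ∀ i j, i ≠ 0 → j ≠ 0 → i ≠ j → ∀ v ∈ part i, ∀ w ∈ part j, ¬ G.Adj v w

end Colorings

section Arcs

variable {α β : Type*}

open scoped Classical in
/-- `e(X, Y)`: the number of arcs from `X` to `Y`. -/
noncomputable def arcCount (A : α → β → Prop) (X : Finset α) (Y : Finset β) : ℕ :=
  ((X ×ˢ Y).filter fun p => A p.1 p.2).card

open scoped Classical in
/-- `δ⁺(X)`: the heads of the arcs with tail in `X`. -/
noncomputable def outNbrs [Fintype β] (A : α → β → Prop) (X : Finset α) : Finset β :=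
  {b | ∃ a ∈ X, A a b}

open scoped Classical in
/-- `δ⁻(Y)`: the tails of the arcs with head in `Y`. -/
noncomputable def inNbrs [Fintype α] (A : α → β → Prop) (Y : Finset β) : Finset α :=
  {a | ∃ b ∈ Y, A a b}

end Arcs

/-- The nodes of the middle layer `F`; the pair `(j, i)` is the node `f^j(i)`, the copy of the
color `i` belonging to the part `U^j`. -/
abbrev Mid (l k₀ : ℕ) : Type := Fin (l + 1) × Fin k₀

/-- `F^0`: the copies of the colors belonging to `U^0`. -/
def midRest (l k₀ : ℕ) : Finset (Mid l k₀) := {f | f.1 = 0}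

/-- `F^C`: the copies of the colors belonging to the cliques `U^1, …, U^l`. -/
def midClique (l k₀ : ℕ) : Finset (Mid l k₀) := {f | f.1 ≠ 0}

/-- The arcs of `A_3`: from `f^j(i)` to the color `i`. -/
def arcMC {l k₀ : ℕ} (f : Mid l k₀) (i : Fin k₀) : Prop := f.2 = i

section Network

variable {V : Type*} [Fintype V] {G : SimpleGraph V} {k l : ℕ} {c : PartialColoring G k}

/-- The arcs of `A_2`: from `v ∈ U^j` to `f^j(i)` whenever the color `i` is free for `v`. -/
def arcUM (P : MixedDecomposition c l) {k₀ : ℕ} (v : V) (f : Mid l k₀) : Prop :=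
  v ∈ P.part f.1 ∧ (f.2 : ℕ) ∈ c.free v

variable (V) in
/-- `⌈n / k₀⌉` with `n = |V|`. -/
def upperSize (k₀ : ℕ) : ℤ := ⌈(Fintype.card V : ℚ) / (k₀ : ℚ)⌉

variable (V) in
/-- `⌊n / k₀⌋` with `n = |V|`. -/
def lowerSize (k₀ : ℕ) : ℤ := ⌊(Fintype.card V : ℚ) / (k₀ : ℚ)⌋

open scoped Classical in
/-- The flow problem on the layers `U`, `F`, `C` (source and sink omitted) has a solution. The
values of `x` and `y` matter only on the arcs of `A_2` and of `A_3`, respectively. -/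
def FlowSolvable (P : MixedDecomposition c l) (k₀ : ℕ) : Prop :=
  ∃ (x : V → Mid l k₀ → ℝ) (y : Mid l k₀ → Fin k₀ → ℝ),
    (∀ u ∈ c.uncolored, ∑ f with arcUM P u f, x u f = 1) ∧
    (∀ f i, arcMC f i → y f i - ∑ u ∈ c.uncolored with arcUM P u f, x u f = 0) ∧
    (∀ i : Fin k₀,
      -(upperSize V k₀ : ℝ) + ((c.cls i).card : ℝ) ≤ -∑ f with arcMC f i, y f i ∧
      -∑ f with arcMC f i, y f i ≤ -(lowerSize V k₀ : ℝ) + ((c.cls i).card : ℝ)) ∧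
    (∀ u f, arcUM P u f → 0 ≤ x u f ∧ x u f ≤ 1) ∧
    (∀ f ∈ midClique l k₀, ∀ i, arcMC f i → 0 ≤ y f i ∧ y f i ≤ 1) ∧
    (∀ f ∈ midRest l k₀, ∀ i, arcMC f i → 0 ≤ y f i ∧ y f i ≤ ((P.part 0).card : ℝ))

/-- Admissible signed selections of nodes: neighboring selected nodes have the same sign. -/
def Compatible (P : MixedDecomposition c l) {k₀ : ℕ} (Rp Rm : Finset V)
    (Sp Sm : Finset (Mid l k₀)) (Tp Tm : Finset (Fin k₀)) : Prop :=
  Rp ⊆ c.uncolored ∧ Rm ⊆ c.uncolored ∧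
  outNbrs (arcUM P) Rp ∩ Sm = ∅ ∧ outNbrs (arcUM P) Rm ∩ Sp = ∅ ∧
  outNbrs arcMC Sp ∩ Tm = ∅ ∧ outNbrs arcMC Sm ∩ Tp = ∅

/-- Left-hand side of the generalized Hall inequality. -/
def hallLHS (c : PartialColoring G k) {k₀ : ℕ} (Rm : Finset V) (Tm : Finset (Fin k₀)) : ℤ :=
  (Rm.card : ℤ) + ∑ i ∈ Tm, (-upperSize V k₀ + ((c.cls i).card : ℤ))

open scoped Classical in
/-- Right-hand side of the generalized Hall inequality. -/
noncomputable def hallRHS (P : MixedDecomposition c l) {k₀ : ℕ} (Rp Rm : Finset V)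
    (Sp Sm : Finset (Mid l k₀)) (Tp Tm : Finset (Fin k₀)) : ℤ :=
  (Rp.card : ℤ) + ∑ i ∈ Tp, (-lowerSize V k₀ + ((c.cls i).card : ℤ))
    + arcCount (arcUM P) Rm (Finset.univ \ Sm)
    + arcCount (arcUM P) (c.uncolored \ Rp) Sp
    + arcCount arcMC (Sm ∩ midClique l k₀) (Finset.univ \ Tm)
    + ((P.part 0).card : ℤ) * arcCount arcMC (Sm ∩ midRest l k₀) (Finset.univ \ Tm)
    + arcCount arcMC (midClique l k₀ \ Sp) Tp
    + ((P.part 0).card : ℤ) * arcCount arcMC (midRest l k₀ \ Sp) Tp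

/-- The generalized Hall inequality of a signed selection of nodes. -/
def HallIneq (P : MixedDecomposition c l) {k₀ : ℕ} (Rp Rm : Finset V)
    (Sp Sm : Finset (Mid l k₀)) (Tp Tm : Finset (Fin k₀)) : Prop :=
  hallLHS c Rm Tm ≤ hallRHS P Rp Rm Sp Sm Tp Tm

/-- The set `R_-` determined by `S_-`: the uncolored vertices with all outgoing arcs into `S_-`. -/
noncomputable def forcedInto (P : MixedDecomposition c l) {k₀ : ℕ} (S : Finset (Mid l k₀)) :
    Finset V :=
  open scoped Classical in {v ∈ c.uncolored | outNbrs (arcUM P) {v} ⊆ S}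

/-- `S ⊇ δ⁻(T)` and `S ∩ F^0 = δ⁻(T) ∩ F^0`. -/
def Admissible {l k₀ : ℕ} (S : Finset (Mid l k₀)) (T : Finset (Fin k₀)) : Prop :=
  inNbrs arcMC T ⊆ S ∧ S ∩ midRest l k₀ = inNbrs arcMC T ∩ midRest l k₀

/-- The reduced condition
`|R_-| + ∑_{i ∈ T_-} (-⌈n/k₀⌉ + |C_i|) ≤ e(S_- ∩ F^C, C \ T_-)`, with `R_-` determined by `S_-`. -/
def ReducedCondition (P : MixedDecomposition c l) {k₀ : ℕ} (S : Finset (Mid l k₀))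
    (T : Finset (Fin k₀)) : Prop :=
  ((forcedInto P S).card : ℤ) + ∑ i ∈ T, (-upperSize V k₀ + ((c.cls i).card : ℤ))
    ≤ (arcCount arcMC (S ∩ midClique l k₀) (Finset.univ \ T) : ℤ)

open scoped Classical in
/-- The practical condition: the number of uncolored vertices whose free colors (among the `k₀`
colors considered) all lie in `T` is at most `∑_{i ∈ T} (⌈n/k₀⌉ - |C_i|)`. -/
def PracticalCondition (c : PartialColoring G k) {k₀ : ℕ} (T : Finset (Fin k₀)) : Prop :=
  (({v ∈ c.uncolored | ∀ i : Fin k₀, (i : ℕ) ∈ c.free v → i ∈ T} : Finset V).card : ℤ)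
    ≤ ∑ i ∈ T, (upperSize V k₀ - ((c.cls i).card : ℤ))

end Network

end EquitableFlow

/-! Merging source and sink into one root turns the flow problem into a circulation problem with arc
bounds (`flowSolvable_iff_circulation`), and Hoffman's theorem (`exists_circulation_iff`) reduces
solvability to one cut condition per node set `X`. If `X` avoids the root, its cut condition is a
Hall inequality with negative sets only; if `X` contains the root, its complement gives one with
positive sets only (`forall_cutCondition_iff`). Conversely, a signed Hall inequality is the sum of
its two one-signed parts (`hallIneq_of_parts`), so nothing is lost.

The negative inequalities with `T_- ≠ ∅` are thinned out by an exchange argument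
(`hall_admissibleHull_le`). Adding `δ⁻(T_-)` to `S_-` is free, since those nodes send no arc to `C \
T_-`. Deleting any other node of `F^0` saves its capacity `|U^0|` and costs at most `|U^0|` arcs, as
only vertices of `U^0` point to it. For fixed `S_-`, a vertex belongs in `R_-` at no cost when all
its arcs end in `S_-`, and otherwise costs at least the 1 it contributes. What survives is the
reduced condition. -/

namespace EquitableFlow

/-! ### Hoffman's circulation theorem, by least squares. -/

section Circulation

variable {N A : Type*} [Fintype A]

open scoped Classical in
/-- Inflow minus outflow of the node `v` under the arc values `x`. -/
noncomputable def netInflow (tail head : A → N) (x : A → ℝ) (v : N) : ℝ :=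
  (∑ a, if head a = v then x a else 0) - ∑ a, if tail a = v then x a else 0

open scoped Classical in
/-- Hoffman's cut condition for the node set `X`: the lower bounds of the entering arcs do not
exceed the upper bounds of the leaving arcs. -/
def CutCondition (tail head : A → N) (lo up : A → ℝ) (X : Set N) : Prop :=
  (∑ a, if head a ∈ X ∧ tail a ∉ X then lo a else 0)
    ≤ ∑ a, if tail a ∈ X ∧ head a ∉ X then up a else 0

-- An arc with both ends in `X` is counted once with each sign and cancels, so only the boundary
-- arcs remain.
open scoped Classical in
theorem sum_netInflow [Fintype N] (tail head : A → N) (x : A → ℝ) (X : Set N) :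
    (∑ v, if v ∈ X then netInflow tail head x v else 0) =
      (∑ a, if head a ∈ X ∧ tail a ∉ X then x a else 0)
        - ∑ a, if tail a ∈ X ∧ head a ∉ X then x a else 0 := by
  have key : ∀ g : A → N, (∑ v, if v ∈ X then (∑ a, if g a = v then x a else 0) else 0)
      = ∑ a, if g a ∈ X then x a else 0 := by
    intro g
    have : ∀ v, (if v ∈ X then (∑ a, if g a = v then x a else 0) else 0)
        = ∑ a, if g a = v then (if g a ∈ X then x a else 0) else 0 := by
      intro v
      split_ifs with h
      · refine Finset.sum_congr rfl fun a _ => ?_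
        split_ifs with h1 h2 <;> simp_all
      · symm
        refine Finset.sum_eq_zero fun a _ => ?_
        split_ifs with h1 h2 <;> simp_all
    simp_rw [this]
    rw [Finset.sum_comm]
    simp
  have h1 : ∀ v, (if v ∈ X then netInflow tail head x v else 0)
      = (if v ∈ X then (∑ a, if head a = v then x a else 0) else 0)
        - (if v ∈ X then (∑ a, if tail a = v then x a else 0) else 0) := by
    intro v
    unfold netInflow
    split_ifs <;> simp
  simp_rw [h1]
  rw [Finset.sum_sub_distrib, key, key, ← Finset.sum_sub_distrib, ← Finset.sum_sub_distrib]
  refine Finset.sum_congr rfl fun a _ => ?_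
  by_cases h1 : head a ∈ X <;> by_cases h2 : tail a ∈ X <;> simp [h1, h2]

theorem sum_netInflow_univ [Fintype N] (tail head : A → N) (x : A → ℝ) :
    ∑ v, netInflow tail head x v = 0 := by
  classical
  simpa using sum_netInflow tail head x Set.univ

-- The difference of indicators also covers loops, where the two changes cancel. It is the direction
-- along which the squared imbalance is differentiated.
open scoped Classical in
theorem netInflow_update (tail head : A → N) (x : A → ℝ) (a : A) (t : ℝ) (v : N) :
    netInflow tail head (Function.update x a (x a + t)) v = netInflow tail head x v
      + t * ((if head a = v then 1 else 0) - if tail a = v then 1 else 0) := by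
  have key : ∀ g : A → N, (∑ b, if g b = v then Function.update x a (x a + t) b else 0)
      = (∑ b, if g b = v then x b else 0) + if g a = v then t else 0 := by
    intro g
    have : ∀ b, (if g b = v then Function.update x a (x a + t) b else 0)
        = (if g b = v then x b else 0) + if b = a then (if g a = v then t else 0) else 0 := by
      intro b
      by_cases hb : b = a
      · subst hb
        by_cases hg : g b = v <;> simp [hg]
      · simp [hb]
    simp_rw [this]
    rw [Finset.sum_add_distrib]
    simp
  unfold netInflow
  rw [key, key]
  split_ifs <;> ring

open scoped Classical in
/-- First-order optimality for a minimizer of the squared net inflow in a box. -/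
theorem sum_sq_netInflow_minimizer [Fintype N] {tail head : A → N} {lo up x : A → ℝ}
    (hx : x ∈ Set.Icc lo up)
    (hmin : ∀ z ∈ Set.Icc lo up, ∑ v, netInflow tail head x v ^ 2
      ≤ ∑ v, netInflow tail head z v ^ 2) (a : A) {t : ℝ}
    (ht : x a + t ∈ Set.Icc (lo a) (up a)) :
    0 ≤ 2 * t * (netInflow tail head x (head a) - netInflow tail head x (tail a))
      + t ^ 2 * ∑ v, ((if head a = v then 1 else 0) - if tail a = v then 1 else 0 : ℝ) ^ 2 := by
  have hz : Function.update x a (x a + t) ∈ Set.Icc lo up := by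
    constructor <;> intro b <;> by_cases hb : b = a
    · subst hb; simpa using ht.1
    · simpa [hb] using hx.1 b
    · subst hb; simpa using ht.2
    · simpa [hb] using hx.2 b
  have h := hmin _ hz
  simp_rw [netInflow_update] at h
  have e : ∀ v, (netInflow tail head x v
      + t * ((if head a = v then 1 else 0) - if tail a = v then 1 else 0)) ^ 2
      = netInflow tail head x v ^ 2
        + 2 * t * ((if head a = v then netInflow tail head x v else 0)
          - if tail a = v then netInflow tail head x v else 0)
        + t ^ 2 * ((if head a = v then 1 else 0) - if tail a = v then 1 else 0 : ℝ) ^ 2 := by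
    intro v
    split_ifs <;> ring
  simp_rw [e] at h
  rw [Finset.sum_add_distrib, Finset.sum_add_distrib, ← Finset.mul_sum, ← Finset.mul_sum,
    Finset.sum_sub_distrib] at h
  simp only [Finset.sum_ite_eq, Finset.mem_univ, if_true] at h
  linarith

/-- Dividing by `t` and letting `t` tend to 0 leaves the linear coefficient. This turns minimality
under small feasible changes into a sign condition. -/
theorem nonneg_of_forall_small {m K δ : ℝ} (hδ : 0 < δ) (hK : 0 ≤ K)
    (h : ∀ t, 0 < t → t ≤ δ → 0 ≤ 2 * t * m + t ^ 2 * K) : 0 ≤ m := by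
  by_contra! hm
  have hK1 : 0 < K + 1 := by linarith
  -- With `t * (K + 1) ≤ -m` one gets `2 * m + t * K < m < 0`; the `+ 1` keeps the denominator
  -- positive when `K = 0`.
  have ht : 0 < min δ (-m / (K + 1)) := lt_min hδ (div_pos (by linarith) hK1)
  have h1 := h _ ht (min_le_left _ _)
  have h2 : min δ (-m / (K + 1)) * (K + 1) ≤ -m :=
    (le_div_iff₀ hK1).1 (min_le_right _ _)
  generalize min δ (-m / (K + 1)) = t at *
  have h3 : 0 ≤ 2 * m + t * K := by
    by_contra! h4
    have := mul_neg_of_pos_of_neg ht h4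
    linarith
  linarith

/-- **Hoffman's circulation theorem**. -/
theorem exists_circulation_iff [Fintype N] (tail head : A → N) {lo up : A → ℝ} (hlu : lo ≤ up) :
    (∃ x ∈ Set.Icc lo up, ∀ v, netInflow tail head x v = 0) ↔
      ∀ X : Set N, CutCondition tail head lo up X := by
  classical
  constructor
  · rintro ⟨x, hx, h0⟩ X
    have h := sum_netInflow tail head x X
    simp only [h0, ite_self, Finset.sum_const_zero] at h
    have h1 : (∑ a, if head a ∈ X ∧ tail a ∉ X then lo a else 0)
        ≤ ∑ a, if head a ∈ X ∧ tail a ∉ X then x a else 0 := by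
      refine Finset.sum_le_sum fun a _ => ?_
      split_ifs
      · exact hx.1 a
      · exact le_rfl
    have h2 : (∑ a, if tail a ∈ X ∧ head a ∉ X then x a else 0)
        ≤ ∑ a, if tail a ∈ X ∧ head a ∉ X then up a else 0 := by
      refine Finset.sum_le_sum fun a _ => ?_
      split_ifs
      · exact hx.2 a
      · exact le_rfl
    unfold CutCondition
    convert (by linarith : (∑ a, if head a ∈ X ∧ tail a ∉ X then lo a else 0)
      ≤ ∑ a, if tail a ∈ X ∧ head a ∉ X then up a else 0)
  · intro hcut
    have hcont : Continuous fun x : A → ℝ => ∑ v, netInflow tail head x v ^ 2 := by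
      unfold netInflow
      refine continuous_finsetSum _ fun v _ => Continuous.pow (Continuous.sub ?_ ?_) 2 <;>
      · refine continuous_finsetSum _ fun a _ => ?_
        split_ifs
        · exact continuous_apply a
        · exact continuous_const
    obtain ⟨x, hx, hmin⟩ := (isCompact_Icc (a := lo) (b := up)).exists_isMinOn
      (Set.nonempty_Icc.2 hlu) hcont.continuousOn
    have hopt := fun a t => sum_sq_netInflow_minimizer (tail := tail) (head := head) hx
      (fun z hz => hmin hz) a (t := t)
    -- Raising the flow on `a` shifts net inflow from the tail to the head, so it would lower the
    -- sum of squares if the tail has the larger value. At a minimizer such an arc is saturated;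
    -- `hlo` is the mirror image.
    have hup : ∀ a, netInflow tail head x (head a) < netInflow tail head x (tail a) →
        x a = up a := by
      intro a ha
      by_contra hne
      have hlt : x a < up a := lt_of_le_of_ne (hx.2 a) hne
      have := nonneg_of_forall_small (sub_pos.2 hlt)
        (Finset.sum_nonneg fun v _ => sq_nonneg _)
        (fun t h0 h1 => hopt a t ⟨by linarith [hx.1 a], by linarith⟩)
      linarith
    have hlo : ∀ a, netInflow tail head x (tail a) < netInflow tail head x (head a) →
        x a = lo a := by
      intro a ha
      by_contra hne
      have hlt : lo a < x a := lt_of_le_of_ne (hx.1 a) (Ne.symm hne)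
      have := nonneg_of_forall_small (sub_pos.2 hlt)
        (m := netInflow tail head x (tail a) - netInflow tail head x (head a))
        (Finset.sum_nonneg fun v _ => sq_nonneg
          ((if head a = v then 1 else 0) - if tail a = v then 1 else 0 : ℝ))
        (fun t h0 h1 => by
          have := hopt a (-t) ⟨by linarith, by linarith [hx.2 a]⟩
          linarith)
      linarith
    -- On the boundary of the set of positive net inflow, leaving arcs are at their upper and
    -- entering arcs at their lower bounds. The cut condition then says that the total net inflow of
    -- the set is at most 0, although every summand is positive.
    have hX := hcut {v | 0 < netInflow tail head x v}
    have hsum := sum_netInflow tail head x {v | 0 < netInflow tail head x v}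
    have e1 : (∑ a, if head a ∈ {v | 0 < netInflow tail head x v}
        ∧ tail a ∉ {v | 0 < netInflow tail head x v} then lo a else 0)
        = ∑ a, if head a ∈ {v | 0 < netInflow tail head x v}
        ∧ tail a ∉ {v | 0 < netInflow tail head x v} then x a else 0 := by
      refine Finset.sum_congr rfl fun a _ => ?_
      split_ifs with h
      · exact (hlo a (lt_of_le_of_lt (not_lt.1 h.2) h.1)).symm
      · rfl
    have e2 : (∑ a, if tail a ∈ {v | 0 < netInflow tail head x v}
        ∧ head a ∉ {v | 0 < netInflow tail head x v} then up a else 0)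
        = ∑ a, if tail a ∈ {v | 0 < netInflow tail head x v}
        ∧ head a ∉ {v | 0 < netInflow tail head x v} then x a else 0 := by
      refine Finset.sum_congr rfl fun a _ => ?_
      split_ifs with h
      · exact (hup a (lt_of_le_of_lt (not_lt.1 h.2) h.1)).symm
      · rfl
    have hle : (∑ v, if v ∈ {v | 0 < netInflow tail head x v}
        then netInflow tail head x v else 0) ≤ 0 := by
      rw [hsum, ← e1, ← e2]
      unfold CutCondition at hX
      exact sub_nonpos.2 (by convert hX)
    have hnn : ∀ v ∈ Finset.univ, 0 ≤ if v ∈ {v | 0 < netInflow tail head x v}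
        then netInflow tail head x v else 0 := by
      intro v _
      split_ifs with h
      · exact le_of_lt h
      · exact le_rfl
    have hall := (Finset.sum_eq_zero_iff_of_nonneg hnn).1
      (le_antisymm hle (Finset.sum_nonneg hnn))
    -- No net inflow is positive and all of them sum to 0, hence each vanishes.
    have hnp : ∀ v ∈ Finset.univ, netInflow tail head x v ≤ 0 := by
      intro v hv
      by_contra! h
      have := hall v hv
      rw [if_pos (show v ∈ {v | 0 < netInflow tail head x v} from h)] at this
      linarith
    exact ⟨x, hx, fun v => (Finset.sum_eq_zero_iff_of_nonpos hnp).1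
      (sum_netInflow_univ tail head x) v (Finset.mem_univ v)⟩

end Circulation

/-! ### The network as a circulation; cut conditions as one-signed Hall inequalities. -/

section CircNetwork

variable {V : Type*} [Fintype V] {G : SimpleGraph V} {k l : ℕ} {c : PartialColoring G k}

/-- The nodes of the flow network, with source and sink merged into the root `none`. -/
abbrev Node (V : Type*) (l k₀ : ℕ) : Type _ := Option (V ⊕ Mid l k₀ ⊕ Fin k₀)

/-- The arcs of the flow network: root to `U`, `U` to `F`, `F` to `C`, `C` to root. -/
abbrev NetArc (V : Type*) (l k₀ : ℕ) : Type _ := V ⊕ (V × Mid l k₀) ⊕ Mid l k₀ ⊕ Fin k₀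

/-- The tail of an arc. -/
def netTail {V : Type*} {l k₀ : ℕ} : NetArc V l k₀ → Node V l k₀ :=
  Sum.elim (fun _ => none) <| Sum.elim (fun p => some (.inl p.1)) <|
    Sum.elim (fun f => some (.inr (.inl f))) fun i => some (.inr (.inr i))

/-- The head of an arc. -/
def netHead {V : Type*} {l k₀ : ℕ} : NetArc V l k₀ → Node V l k₀ :=
  Sum.elim (fun v => some (.inl v)) <| Sum.elim (fun p => some (.inr (.inl p.2))) <|
    Sum.elim (fun f => some (.inr (.inr f.2))) fun _ => none

theorem sum_netArc {V : Type*} [Fintype V] {l k₀ : ℕ} (g : NetArc V l k₀ → ℝ) :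
    ∑ a, g a = (∑ v, g (.inl v)) + ((∑ v, ∑ f, g (.inr (.inl (v, f))))
      + ((∑ f, g (.inr (.inr (.inl f)))) + ∑ i, g (.inr (.inr (.inr i))))) := by
  rw [Fintype.sum_sum_type, Fintype.sum_sum_type, Fintype.sum_sum_type, Fintype.sum_prod_type]

/-- The capacity of the arc leaving a middle node. -/
def midCap (P : MixedDecomposition c l) {k₀ : ℕ} (f : Mid l k₀) : ℝ :=
  if f.1 = 0 then ((P.part 0).card : ℝ) else 1

open scoped Classical in
/-- Lower bounds of the arcs. -/
noncomputable def netLo (c : PartialColoring G k) (l k₀ : ℕ) : NetArc V l k₀ → ℝ :=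
  Sum.elim (fun v => if v ∈ c.uncolored then 1 else 0) <| Sum.elim (fun _ => 0) <|
    Sum.elim (fun _ => 0) fun i => (lowerSize V k₀ : ℝ) - ((c.cls i).card : ℝ)

open scoped Classical in
/-- Upper bounds of the arcs. -/
noncomputable def netUp (P : MixedDecomposition c l) (k₀ : ℕ) : NetArc V l k₀ → ℝ :=
  Sum.elim (fun v => if v ∈ c.uncolored then 1 else 0) <|
    Sum.elim (fun p => if arcUM P p.1 p.2 then 1 else 0) <|
    Sum.elim (midCap P) fun i => (upperSize V k₀ : ℝ) - ((c.cls i).card : ℝ)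

theorem midCap_nonneg (P : MixedDecomposition c l) {k₀ : ℕ} (f : Mid l k₀) : 0 ≤ midCap P f := by
  unfold midCap
  split_ifs <;> positivity

theorem netLo_le_netUp (P : MixedDecomposition c l) (k₀ : ℕ) : netLo c l k₀ ≤ netUp P k₀ := by
  have h : (lowerSize V k₀ : ℝ) ≤ upperSize V k₀ := by
    exact_mod_cast Int.floor_le_ceil _
  rintro (v | p | f | i)
  · exact le_rfl
  · simp only [netLo, netUp, Sum.elim_inl, Sum.elim_inr]
    split_ifs <;> norm_num
  · exact midCap_nonneg P f
  · simpa [netLo, netUp] using h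

theorem arcUM_mem_uncolored {P : MixedDecomposition c l} {k₀ : ℕ} {v : V} {f : Mid l k₀}
    (h : arcUM P v f) : v ∈ c.uncolored :=
  (P.cover v).2 ⟨_, h.1⟩

open scoped Classical in
theorem arcCount_eq_sum {α β : Type*} [Fintype α] [Fintype β] (A : α → β → Prop) (X : Finset α)
    (Y : Finset β) :
    arcCount A X Y = ∑ a, ∑ b, if a ∈ X ∧ b ∈ Y ∧ A a b then 1 else 0 := by
  rw [← Fintype.sum_prod_type', arcCount, ← Finset.sum_filter, Finset.card_eq_sum_ones]
  refine Finset.sum_congr ?_ fun _ _ => rfl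
  ext p
  simp [and_assoc]

open scoped Classical in
theorem arcCount_arcMC_eq_sum {l k₀ : ℕ} (S : Finset (Mid l k₀)) (T : Finset (Fin k₀)) :
    arcCount arcMC S T = ∑ f, if f ∈ S ∧ f.2 ∈ T then 1 else 0 := by
  rw [arcCount_eq_sum]
  refine Finset.sum_congr rfl fun f _ => ?_
  rw [Finset.sum_eq_single f.2]
  · simp [arcMC]
  · intro b _ hb
    simp [arcMC, hb.symm]
  · simp

@[simp]
theorem arcCount_empty_left {α β : Type*} (A : α → β → Prop) (Y : Finset β) :
    arcCount A ∅ Y = 0 := by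
  simp [arcCount]

@[simp]
theorem arcCount_empty_right {α β : Type*} (A : α → β → Prop) (X : Finset α) :
    arcCount A X ∅ = 0 := by
  simp [arcCount]

-- Each middle node has a single outgoing arc, to its own color, so capacities can be summed over
-- nodes. Separating `F^0` from `F^C` yields the two capacity terms of the Hall inequality.
open scoped Classical in
theorem sum_midCap (P : MixedDecomposition c l) {k₀ : ℕ} (S : Finset (Mid l k₀))
    (T : Finset (Fin k₀)) :
    (∑ f, if f ∈ S ∧ f.2 ∈ T then midCap P f else 0)
      = arcCount arcMC (S ∩ midClique l k₀) T
        + ((P.part 0).card : ℝ) * arcCount arcMC (S ∩ midRest l k₀) T := by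
  rw [arcCount_arcMC_eq_sum, arcCount_arcMC_eq_sum]
  push_cast
  rw [Finset.mul_sum, ← Finset.sum_add_distrib]
  refine Finset.sum_congr rfl fun f _ => ?_
  by_cases h : f.1 = 0 <;> simp [midCap, midClique, midRest, h]

theorem hallRHS_minus (P : MixedDecomposition c l) {k₀ : ℕ} (R : Finset V)
    (S : Finset (Mid l k₀)) (T : Finset (Fin k₀)) :
    hallRHS P ∅ R ∅ S ∅ T = arcCount (arcUM P) R (Finset.univ \ S)
      + arcCount arcMC (S ∩ midClique l k₀) (Finset.univ \ T)
      + ((P.part 0).card : ℤ) * arcCount arcMC (S ∩ midRest l k₀) (Finset.univ \ T) := by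
  simp [hallRHS]

open scoped Classical in
theorem hallRHS_plus (P : MixedDecomposition c l) {k₀ : ℕ} (R : Finset V)
    (S : Finset (Mid l k₀)) (T : Finset (Fin k₀)) :
    hallRHS P R ∅ S ∅ T ∅ = R.card + ∑ i ∈ T, (-lowerSize V k₀ + ((c.cls i).card : ℤ))
      + arcCount (arcUM P) (c.uncolored \ R) S
      + arcCount arcMC (midClique l k₀ \ S) T
      + ((P.part 0).card : ℤ) * arcCount arcMC (midRest l k₀ \ S) T := by
  simp [hallRHS]

open scoped Classical in
/-- Every Hall inequality is the sum of its negative and its positive part. -/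
theorem hallIneq_of_parts (P : MixedDecomposition c l) {k₀ : ℕ} {Rp Rm : Finset V}
    {Sp Sm : Finset (Mid l k₀)} {Tp Tm : Finset (Fin k₀)} (hm : HallIneq P ∅ Rm ∅ Sm ∅ Tm)
    (hp : HallIneq P Rp ∅ Sp ∅ Tp ∅) : HallIneq P Rp Rm Sp Sm Tp Tm := by
  unfold HallIneq at *
  rw [hallRHS_minus] at hm
  rw [hallRHS_plus] at hp
  unfold hallRHS
  simp only [hallLHS, Finset.card_empty, Finset.sum_empty] at *
  push_cast at *
  linarith

open scoped Classical in
/-- The cut condition of the flow network, arc class by arc class. -/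
theorem cutCondition_net_iff (P : MixedDecomposition c l) (k₀ : ℕ) (X : Set (Node V l k₀)) :
    CutCondition netTail netHead (netLo c l k₀) (netUp P k₀) X ↔
      (∑ v, if some (.inl v) ∈ X ∧ none ∉ X then (if v ∈ c.uncolored then (1 : ℝ) else 0) else 0)
        + (∑ i : Fin k₀, if none ∈ X ∧ some (.inr (.inr i)) ∉ X
          then (lowerSize V k₀ : ℝ) - ((c.cls i).card : ℝ) else 0)
      ≤ (∑ v, if none ∈ X ∧ some (.inl v) ∉ X
          then (if v ∈ c.uncolored then (1 : ℝ) else 0) else 0)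
        + ((∑ v, ∑ f, if some (.inl v) ∈ X ∧ some (.inr (.inl f)) ∉ X
          then (if arcUM P v f then (1 : ℝ) else 0) else 0)
        + ((∑ f : Mid l k₀, if some (.inr (.inl f)) ∈ X ∧ some (.inr (.inr f.2)) ∉ X
          then midCap P f else 0)
        + ∑ i : Fin k₀, if some (.inr (.inr i)) ∈ X ∧ none ∉ X
          then (upperSize V k₀ : ℝ) - ((c.cls i).card : ℝ) else 0)) := by
  -- The two zeros stand for the arc classes `U` to `F` and `F` to `C`, whose lower bounds vanish;
  -- they match the four-term shape of `sum_netArc`.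
  have h : ∀ {a b d : ℝ}, a + d ≤ b ↔ a + (0 + (0 + d)) ≤ b := by simp
  rw [h]
  unfold CutCondition
  rw [sum_netArc, sum_netArc]
  have h1 : ∀ v : V, ∀ f : Mid l k₀,
      (if netHead (.inr (.inl (v, f))) ∈ X ∧ netTail (.inr (.inl (v, f))) ∉ X
        then netLo c l k₀ (.inr (.inl (v, f))) else 0) = 0 := fun _ _ => ite_self 0
  have h2 : ∀ f : Mid l k₀,
      (if netHead (.inr (.inr (.inl f))) ∈ X ∧ netTail (.inr (.inr (.inl f))) ∉ X
        then netLo c l k₀ (.inr (.inr (.inl f))) else 0) = 0 := fun _ => ite_self 0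
  simp only [h1, h2, Finset.sum_const_zero]
  exact Iff.rfl

-- The root lies outside `X`, so the only entering arcs with nonzero lower bound run from the root
-- to `U` and count `R_-`. The color-to-root arcs leave `X`, which is why `⌈n/k₀⌉` appears.
open scoped Classical in
theorem cutCondition_iff_of_notMem (P : MixedDecomposition c l) (k₀ : ℕ)
    {X : Set (Node V l k₀)} (hX : none ∉ X) :
    CutCondition netTail netHead (netLo c l k₀) (netUp P k₀) X ↔
      HallIneq P ∅ {v ∈ c.uncolored | some (.inl v) ∈ X} ∅ {f | some (.inr (.inl f)) ∈ X} ∅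
        ({i | some (.inr (.inr i)) ∈ X} : Finset (Fin k₀)) := by
  unfold HallIneq
  rw [hallRHS_minus, hallLHS]
  rw [← Int.cast_le (R := ℝ)]
  push_cast
  rw [add_assoc (arcCount _ _ _ : ℝ), ← sum_midCap, arcCount_eq_sum]
  rw [cutCondition_net_iff]
  simp only [hX, not_false_iff, and_true, false_and, if_false, Finset.sum_const_zero, add_zero,
    zero_add]
  have e1 : (∑ v, if some (.inl v) ∈ X then (if v ∈ c.uncolored then (1 : ℝ) else 0) else 0)
      = (({v ∈ c.uncolored | some (.inl v) ∈ X} : Finset V).card : ℝ) := by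
    rw [Finset.card_filter]
    push_cast
    rw [← Finset.sum_filter, ← Finset.sum_filter, ← Finset.sum_filter, Finset.filter_filter]
    refine Finset.sum_congr ?_ fun _ _ => rfl
    ext v
    simp [and_comm]
  have e2 : ∀ v f, (if some (Sum.inl v) ∈ X ∧ some (Sum.inr (Sum.inl f)) ∉ X then
      (if arcUM P v f then (1 : ℝ) else 0) else 0) =
      if v ∈ ({v ∈ c.uncolored | some (.inl v) ∈ X} : Finset V)
        ∧ f ∈ Finset.univ \ ({f | some (.inr (.inl f)) ∈ X} : Finset (Mid l k₀)) ∧ arcUM P v f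
        then 1 else 0 := by
    intro v f
    rw [← ite_and]
    refine if_congr ?_ rfl rfl
    -- The tail of an arc into `F` is uncolored, so restricting the count to uncolored vertices
    -- changes nothing.
    have := @arcUM_mem_uncolored _ _ _ _ _ _ P k₀ v f
    simp
    tauto
  rw [e1]
  simp_rw [e2]
  simp only [Finset.mem_filter, Finset.mem_sdiff, Finset.mem_univ, true_and, Finset.sum_filter]
  push_cast
  have e3 : (∑ i, if some (Sum.inr (Sum.inr i)) ∈ X
        then -(upperSize V k₀ : ℝ) + ((c.cls i).card : ℝ) else 0)
      = -∑ i : Fin k₀, if some (Sum.inr (Sum.inr i)) ∈ X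
        then (upperSize V k₀ : ℝ) - ((c.cls i).card : ℝ) else 0 := by
    rw [← Finset.sum_neg_distrib]
    refine Finset.sum_congr rfl fun i _ => ?_
    split_ifs <;> ring
  rw [e3, ← sub_eq_add_neg, sub_le_iff_le_add, add_assoc]

-- The signed sets are now the nodes outside `X`. Color-to-root arcs enter `X` and contribute their
-- lower bounds, hence `⌊n/k₀⌋`; root-to-`U` arcs leave it and count `R_+`.
open scoped Classical in
theorem cutCondition_iff_of_mem (P : MixedDecomposition c l) (k₀ : ℕ)
    {X : Set (Node V l k₀)} (hX : none ∈ X) :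
    CutCondition netTail netHead (netLo c l k₀) (netUp P k₀) X ↔
      HallIneq P {v ∈ c.uncolored | some (.inl v) ∉ X} ∅ {f | some (.inr (.inl f)) ∉ X} ∅
        ({i | some (.inr (.inr i)) ∉ X} : Finset (Fin k₀)) ∅ := by
  unfold HallIneq
  rw [hallRHS_plus, hallLHS]
  rw [← Int.cast_le (R := ℝ)]
  push_cast
  have e0 : ∀ S Q : Finset (Mid l k₀), Q \ S = Sᶜ ∩ Q := by
    intro S Q
    ext
    simp [and_comm]
  rw [add_assoc (_ + (arcCount _ _ _ : ℝ)), e0 _ (midClique l k₀), e0 _ (midRest l k₀),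
    ← sum_midCap, arcCount_eq_sum]
  rw [cutCondition_net_iff]
  simp only [hX, not_true, and_false, true_and, if_false, Finset.sum_const_zero, add_zero, zero_add]
  have e1 : (∑ v, if some (.inl v) ∉ X then (if v ∈ c.uncolored then (1 : ℝ) else 0) else 0)
      = (({v ∈ c.uncolored | some (.inl v) ∉ X} : Finset V).card : ℝ) := by
    rw [Finset.card_filter]
    push_cast
    rw [← Finset.sum_filter, ← Finset.sum_filter, ← Finset.sum_filter, Finset.filter_filter]
    refine Finset.sum_congr ?_ fun _ _ => rfl
    ext v
    simp [and_comm]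
  have e2 : ∀ v f, (if some (Sum.inl v) ∈ X ∧ some (Sum.inr (Sum.inl f)) ∉ X then
      (if arcUM P v f then (1 : ℝ) else 0) else 0) =
      if v ∈ c.uncolored \ ({v ∈ c.uncolored | some (.inl v) ∉ X} : Finset V)
        ∧ f ∈ ({f | some (.inr (.inl f)) ∉ X} : Finset (Mid l k₀)) ∧ arcUM P v f
        then 1 else 0 := by
    intro v f
    rw [← ite_and]
    refine if_congr ?_ rfl rfl
    have := @arcUM_mem_uncolored _ _ _ _ _ _ P k₀ v f
    simp
    tauto
  rw [e1]
  simp_rw [e2]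
  simp only [Finset.mem_filter, Finset.mem_sdiff, Finset.mem_univ, true_and, Finset.sum_filter,
    Finset.mem_compl, not_not, Finset.card_empty, Finset.sum_empty]
  push_cast
  have e3 : (∑ i, if some (Sum.inr (Sum.inr i)) ∉ X
        then -(lowerSize V k₀ : ℝ) + ((c.cls i).card : ℝ) else 0)
      = -∑ i : Fin k₀, if some (Sum.inr (Sum.inr i)) ∉ X
        then (lowerSize V k₀ : ℝ) - ((c.cls i).card : ℝ) else 0 := by
    rw [← Finset.sum_neg_distrib]
    refine Finset.sum_congr rfl fun i _ => ?_
    split_ifs <;> ring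
  rw [e3]
  constructor <;> intro h <;> linarith

/-- The node set with the given vertices, middle nodes and colors, the root excluded. -/
def nodeSet {l k₀ : ℕ} (R : Finset V) (S : Finset (Mid l k₀)) (T : Finset (Fin k₀)) :
    Set (Node V l k₀) :=
  {n | Option.elim n False (Sum.elim (· ∈ R) (Sum.elim (· ∈ S) (· ∈ T)))}

theorem forall_cutCondition_iff (P : MixedDecomposition c l) (k₀ : ℕ) :
    (∀ X, CutCondition netTail netHead (netLo c l k₀) (netUp P k₀) X) ↔
      (∀ (R : Finset V) (S : Finset (Mid l k₀)) (T : Finset (Fin k₀)), R ⊆ c.uncolored →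
        HallIneq P ∅ R ∅ S ∅ T) ∧
      (∀ (R : Finset V) (S : Finset (Mid l k₀)) (T : Finset (Fin k₀)), R ⊆ c.uncolored →
        HallIneq P R ∅ S ∅ T ∅) := by
  classical
  constructor
  · intro h
    constructor
    · intro R S T hR
      have := (cutCondition_iff_of_notMem P k₀ (X := nodeSet R S T) (by simp [nodeSet])).1 (h _)
      convert this using 1
      · ext v
        have := @hR v
        rw [Finset.mem_filter]
        simp [nodeSet]
        tauto
      · ext; rw [Finset.mem_filter]; simp [nodeSet]
      · ext; rw [Finset.mem_filter]; simp [nodeSet]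
    · intro R S T hR
      have := (cutCondition_iff_of_mem P k₀ (X := (nodeSet R S T)ᶜ) (by simp [nodeSet])).1 (h _)
      convert this using 1
      · ext v
        have := @hR v
        simp [nodeSet]
        tauto
      · ext; simp [nodeSet]
      · ext; simp [nodeSet]
  · rintro ⟨hm, hp⟩ X
    by_cases hX : none ∈ X
    · exact (cutCondition_iff_of_mem P k₀ hX).2 (hp _ _ _ (Finset.filter_subset _ _))
    · exact (cutCondition_iff_of_notMem P k₀ hX).2 (hm _ _ _ (Finset.filter_subset _ _))

end CircNetwork

/-! ### Equivalence of the flow problem with the circulation. -/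

section Solvability

variable {V : Type*} [Fintype V] {G : SimpleGraph V} {k l : ℕ} {c : PartialColoring G k}

open scoped Classical in
theorem flowSolvable_iff_circulation (P : MixedDecomposition c l) (k₀ : ℕ) :
    FlowSolvable P k₀ ↔
      ∃ x ∈ Set.Icc (netLo c l k₀) (netUp P k₀), ∀ n, netInflow netTail netHead x n = 0 := by
  constructor
  · rintro ⟨x, y, hU, hF, hC, hx, hyC, hy0⟩
    -- The flow is extended by 0 to pairs that are not arcs, by one unit from the root to each
    -- uncolored vertex, and by the inflow of each color back to the root.
    set z : NetArc V l k₀ → ℝ := Sum.elim (fun v => if v ∈ c.uncolored then 1 else 0) <|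
      Sum.elim (fun p => if arcUM P p.1 p.2 then x p.1 p.2 else 0) <|
      Sum.elim (fun f => y f f.2) fun i => ∑ f with arcMC f i, y f i with hz
    have hy : ∀ f : Mid l k₀, 0 ≤ y f f.2 ∧ y f f.2 ≤ midCap P f := by
      intro f
      by_cases h : f.1 = 0
      · simpa [midCap, h] using hy0 f (by simp [midRest, h]) f.2 rfl
      · simpa [midCap, h] using hyC f (by simp [midClique, h]) f.2 rfl
    have hsome : ∀ m, netInflow netTail netHead z (some m) = 0 := by
      rintro (v | f | i)
      · simp only [netInflow, sum_netArc, netTail, netHead, hz,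
          Sum.elim_inl, Sum.elim_inr, Option.some.injEq, reduceCtorEq, Sum.inl.injEq, if_false,
          Finset.sum_const_zero, add_zero, zero_add, Finset.sum_ite_eq', Finset.mem_univ, if_true]
        rw [Finset.sum_comm]
        simp only [Finset.sum_ite_eq', Finset.mem_univ, if_true]
        rw [← Finset.sum_filter]
        by_cases hv : v ∈ c.uncolored
        · rw [hU v hv]; simp [hv]
        · rw [Finset.filter_false_of_mem fun f _ h => hv (arcUM_mem_uncolored h)]; simp [hv]
      · simp only [netInflow, sum_netArc, netTail, netHead, hz,
          Sum.elim_inl, Sum.elim_inr, Option.some.injEq, reduceCtorEq, Sum.inl.injEq,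
          Sum.inr.injEq, if_false,
          Finset.sum_const_zero, add_zero, zero_add, Finset.sum_ite_eq', Finset.mem_univ, if_true]
        have h := hF f f.2 rfl
        rw [Finset.sum_filter] at h
        rw [← Finset.sum_subset (Finset.subset_univ c.uncolored)
          fun v _ hv => if_neg fun h => hv (arcUM_mem_uncolored h)]
        linarith
      · simp only [netInflow, sum_netArc, netTail, netHead, hz,
          Sum.elim_inl, Sum.elim_inr, Option.some.injEq, reduceCtorEq,
          Sum.inr.injEq, if_false,
          Finset.sum_const_zero, add_zero, zero_add, Finset.sum_ite_eq', Finset.mem_univ, if_true]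
        rw [← Finset.sum_filter, sub_eq_zero]
        refine Finset.sum_congr (by ext f; rw [Finset.mem_filter, Finset.mem_filter]; rfl) fun f hf => ?_
        rw [(Finset.mem_filter.1 hf).2]
    refine ⟨z, ⟨?_, ?_⟩, ?_⟩
    · rintro (v | p | f | i)
      · exact le_rfl
      · simp only [netLo, hz, Sum.elim_inl, Sum.elim_inr]
        split_ifs with h
        exacts [(hx _ _ h).1, le_rfl]
      · exact (hy f).1
      · simp only [netLo, hz, Sum.elim_inr]
        linarith [(hC i).2]
    · rintro (v | p | f | i)
      · exact le_rfl
      · simp only [netUp, hz, Sum.elim_inl, Sum.elim_inr]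
        split_ifs with h
        exacts [(hx _ _ h).2, le_rfl]
      · exact (hy f).2
      · simp only [netUp, hz, Sum.elim_inr]
        linarith [(hC i).1]
    -- Conservation at the root is automatic: net inflows sum to 0 and all others vanish.
    · rintro (_ | m)
      · have h := sum_netInflow_univ netTail netHead z
        rw [Fintype.sum_option] at h
        simpa [hsome] using h
      · exact hsome m
  · rintro ⟨z, ⟨hlo, hup⟩, h0⟩
    have hxle : ∀ v f, ¬ arcUM P v f → z (.inr (.inl (v, f))) = 0 := by
      intro v f h
      have h1 := hlo (.inr (.inl (v, f)))
      have h2 := hup (.inr (.inl (v, f)))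
      simp only [netLo, netUp, Sum.elim_inl, Sum.elim_inr, h, if_false] at h1 h2
      exact le_antisymm h2 h1
    refine ⟨fun v f => z (.inr (.inl (v, f))), fun f _ => z (.inr (.inr (.inl f))),
      ?_, ?_, ?_, ?_, ?_, ?_⟩
    · intro v hv
      have h := h0 (some (.inl v))
      simp only [netInflow, sum_netArc, netTail, netHead,
          Sum.elim_inl, Sum.elim_inr, Option.some.injEq, reduceCtorEq, Sum.inl.injEq, if_false,
          Finset.sum_const_zero, add_zero, zero_add, Finset.sum_ite_eq', Finset.mem_univ,
          if_true] at h
      rw [Finset.sum_comm] at h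
      simp only [Finset.sum_ite_eq', Finset.mem_univ, if_true] at h
      have h1 := hlo (.inl v)
      have h2 := hup (.inl v)
      simp only [netLo, netUp, Sum.elim_inl, hv, if_true] at h1 h2
      rw [Finset.sum_filter_of_ne fun f _ hf => not_not.1 fun hn => hf (hxle v f hn)]
      linarith
    · rintro f i rfl
      have h := h0 (some (.inr (.inl f)))
      simp only [netInflow, sum_netArc, netTail, netHead,
          Sum.elim_inl, Sum.elim_inr, Option.some.injEq, reduceCtorEq, Sum.inl.injEq,
          Sum.inr.injEq, if_false,
          Finset.sum_const_zero, add_zero, zero_add, Finset.sum_ite_eq', Finset.mem_univ,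
          if_true] at h
      rw [Finset.sum_filter_of_ne fun v _ hv => not_not.1 fun hn => hv (hxle v f hn),
        Finset.sum_subset (Finset.subset_univ c.uncolored)
          fun v _ hv => hxle v f fun h => hv (arcUM_mem_uncolored h)]
      linarith
    · intro i
      have h := h0 (some (.inr (.inr i)))
      simp only [netInflow, sum_netArc, netTail, netHead,
          Sum.elim_inl, Sum.elim_inr, Option.some.injEq, reduceCtorEq,
          Sum.inr.injEq, if_false,
          Finset.sum_const_zero, add_zero, zero_add, Finset.sum_ite_eq', Finset.mem_univ,
          if_true] at h
      rw [← Finset.sum_filter] at h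
      have h1 := hlo (.inr (.inr (.inr i)))
      have h2 := hup (.inr (.inr (.inr i)))
      simp only [netLo, netUp, Sum.elim_inr] at h1 h2
      have e : ∑ f with arcMC f i, z (.inr (.inr (.inl f)))
          = ∑ f : Mid l k₀ with f.2 = i, z (.inr (.inr (.inl f))) :=
        Finset.sum_congr (by ext f; rw [Finset.mem_filter, Finset.mem_filter]; rfl) fun _ _ => rfl
      rw [e]
      constructor <;> linarith
    · intro v f h
      have h1 := hlo (.inr (.inl (v, f)))
      have h2 := hup (.inr (.inl (v, f)))
      simp only [netLo, netUp, Sum.elim_inl, Sum.elim_inr, h, if_true] at h1 h2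
      exact ⟨h1, h2⟩
    · intro f hf i _
      have h1 := hlo (.inr (.inr (.inl f)))
      have h2 := hup (.inr (.inr (.inl f)))
      have hf : f.1 ≠ 0 := by simpa [midClique] using hf
      simp only [netLo, netUp, midCap, Sum.elim_inl, Sum.elim_inr, hf, if_false] at h1 h2
      exact ⟨h1, h2⟩
    · intro f hf i _
      have h1 := hlo (.inr (.inr (.inl f)))
      have h2 := hup (.inr (.inr (.inl f)))
      have hf : f.1 = 0 := by simpa [midRest] using hf
      simp only [netLo, netUp, midCap, Sum.elim_inl, Sum.elim_inr, hf, if_true] at h1 h2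
      exact ⟨h1, h2⟩

/-- The flow problem is solvable iff the purely negative and the purely positive Hall
inequalities hold. -/
theorem flowSolvable_iff_hallIneq (P : MixedDecomposition c l) (k₀ : ℕ) :
    FlowSolvable P k₀ ↔
      (∀ (R : Finset V) (S : Finset (Mid l k₀)) (T : Finset (Fin k₀)), R ⊆ c.uncolored →
        HallIneq P ∅ R ∅ S ∅ T) ∧
      (∀ (R : Finset V) (S : Finset (Mid l k₀)) (T : Finset (Fin k₀)), R ⊆ c.uncolored →
        HallIneq P R ∅ S ∅ T ∅) := by
  rw [flowSolvable_iff_circulation, exists_circulation_iff _ _ (netLo_le_netUp P k₀),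
    forall_cutCondition_iff]

end Solvability

/-! ### Reduction to admissible `S_-`. -/

section Reduction

variable {V : Type*} [Fintype V] {G : SimpleGraph V} {k l k₀ : ℕ} {c : PartialColoring G k}

theorem mem_inNbrs_arcMC {T : Finset (Fin k₀)} {f : Mid l k₀} :
    f ∈ inNbrs arcMC T ↔ f.2 ∈ T := by
  simp [inNbrs, arcMC]

theorem mem_forcedInto {P : MixedDecomposition c l} {S : Finset (Mid l k₀)} {v : V} :
    v ∈ forcedInto P S ↔ v ∈ c.uncolored ∧ ∀ f, arcUM P v f → f ∈ S := by
  classical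
  rw [forcedInto, Finset.mem_filter, Finset.subset_iff]
  simp [outNbrs]

theorem forcedInto_subset (P : MixedDecomposition c l) (S : Finset (Mid l k₀)) :
    forcedInto P S ⊆ c.uncolored :=
  fun _ hv => (mem_forcedInto.1 hv).1

theorem arcCount_eq_zero {α β : Type*} {A : α → β → Prop} {X : Finset α} {Y : Finset β}
    (h : ∀ a ∈ X, ∀ b ∈ Y, ¬ A a b) : arcCount A X Y = 0 := by
  classical
  rw [arcCount, Finset.card_eq_zero, Finset.filter_eq_empty_iff]
  rintro ⟨a, b⟩ hp
  rw [Finset.mem_product] at hp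
  exact h a hp.1 b hp.2

theorem arcCount_forcedInto (P : MixedDecomposition c l) (S : Finset (Mid l k₀)) :
    arcCount (arcUM P) (forcedInto P S) (Finset.univ \ S) = 0 :=
  arcCount_eq_zero fun _ ha b hb h => (Finset.mem_sdiff.1 hb).2 ((mem_forcedInto.1 ha).2 b h)

/-- Both other terms vanish: no arc leaves `S` from the forced vertices, and on `F^0` the set agrees
with `δ⁻(T)`, whose arcs all end in `T`. -/
theorem hallRHS_forcedInto (P : MixedDecomposition c l) {S : Finset (Mid l k₀)}
    {T : Finset (Fin k₀)} (hS : Admissible S T) :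
    hallRHS P ∅ (forcedInto P S) ∅ S ∅ T
      = (arcCount arcMC (S ∩ midClique l k₀) (Finset.univ \ T) : ℤ) := by
  rw [hallRHS_minus, arcCount_forcedInto, hS.2, arcCount_eq_zero (X := _ ∩ midRest l k₀)]
  · simp
  · intro f hf i hi h
    have h1 := mem_inNbrs_arcMC.1 (Finset.mem_inter.1 hf).1
    rw [h] at h1
    exact (Finset.mem_sdiff.1 hi).2 h1

theorem hallIneq_forcedInto_iff (P : MixedDecomposition c l) {S : Finset (Mid l k₀)}
    {T : Finset (Fin k₀)} (hS : Admissible S T) :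
    HallIneq P ∅ (forcedInto P S) ∅ S ∅ T ↔ ReducedCondition P S T := by
  rw [HallIneq, hallRHS_forcedInto P hS]
  rfl

/-- A vertex of `R` that is not forced has an arc ending outside `S`; distinct vertices give
distinct arcs. -/
theorem card_le_arcCount_add_card_forcedInto (P : MixedDecomposition c l) {R : Finset V} (S : Finset (Mid l k₀))
    (hR : R ⊆ c.uncolored) :
    R.card ≤ arcCount (arcUM P) R (Finset.univ \ S) + (forcedInto P S).card := by
  classical
  have h1 : (R \ forcedInto P S).card ≤ arcCount (arcUM P) R (Finset.univ \ S) := by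
    have hex : ∀ v ∈ R \ forcedInto P S, ∃ f, arcUM P v f ∧ f ∉ S := by
      intro v hv
      rw [Finset.mem_sdiff, mem_forcedInto] at hv
      by_contra! h
      exact hv.2 ⟨hR hv.1, h⟩
    rw [arcCount]
    refine le_trans (Finset.card_le_card fun v hv => ?_) (Finset.card_image_le (f := Prod.fst))
    obtain ⟨f, hf, hS⟩ := hex v hv
    rw [Finset.mem_image]
    refine ⟨(v, f), ?_, rfl⟩
    simp [(Finset.mem_sdiff.1 hv).1, hf, hS]
  have h2 := Finset.card_le_card_sdiff_add_card (s := R) (t := forcedInto P S)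
  omega

/-- The admissible set obtained from `S` by adding `δ⁻(T)` and deleting the other nodes of
`F^0`. -/
def admissibleHull (S : Finset (Mid l k₀)) (T : Finset (Fin k₀)) : Finset (Mid l k₀) :=
  {f | f.2 ∈ T ∨ (f ∈ S ∧ f.1 ≠ 0)}

theorem admissible_admissibleHull (S : Finset (Mid l k₀)) (T : Finset (Fin k₀)) :
    Admissible (admissibleHull S T) T := by
  constructor
  · intro f hf
    simp [admissibleHull, mem_inNbrs_arcMC.1 hf]
  · ext f
    simp only [Finset.mem_inter, mem_inNbrs_arcMC, midRest, admissibleHull, Finset.mem_filter,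
      Finset.mem_univ, true_and]
    tauto

-- An arc newly counted ends in a deleted node, which lies in `F^0` and has color outside `T`. Its
-- tail is then in `U^0`, so there are at most `|U^0|` such arcs per deleted node.
open scoped Classical in
theorem arcCount_admissibleHull_le (P : MixedDecomposition c l) (R : Finset V)
    (S : Finset (Mid l k₀)) (T : Finset (Fin k₀)) :
    arcCount (arcUM P) R (Finset.univ \ admissibleHull S T)
      ≤ arcCount (arcUM P) R (Finset.univ \ S)
        + (P.part 0).card * arcCount arcMC (S ∩ midRest l k₀) (Finset.univ \ T) := by
  have hcard : arcCount arcMC (S ∩ midRest l k₀) (Finset.univ \ T)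
      = ({f ∈ S ∩ midRest l k₀ | f.2 ∉ T} : Finset (Mid l k₀)).card := by
    rw [arcCount_arcMC_eq_sum, Finset.card_filter, ← Finset.sum_filter, ← Finset.sum_filter]
    refine Finset.sum_congr ?_ fun _ _ => rfl
    ext f
    simp
  rw [hcard, ← Finset.card_product]
  refine le_trans (Finset.card_le_card ?_) (Finset.card_union_le _ _)
  rintro ⟨v, f⟩ h
  simp only [Finset.mem_filter, Finset.mem_product, Finset.mem_sdiff, Finset.mem_univ, true_and,
    admissibleHull, Finset.mem_union, Finset.mem_inter, midRest] at h ⊢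
  obtain ⟨⟨hv, hf⟩, ha⟩ := h
  push Not at hf
  by_cases hS : f ∈ S
  · have h0 := hf.2 hS
    exact Or.inr ⟨h0 ▸ ha.1, ⟨hS, h0⟩, hf.1⟩
  · exact Or.inl ⟨⟨hv, hS⟩, ha⟩

-- Inside `F^C` the hull only adds nodes with color in `T`, and these have no arc to the other
-- colors.
open scoped Classical in
theorem arcCount_admissibleHull_midClique (S : Finset (Mid l k₀)) (T : Finset (Fin k₀)) :
    arcCount arcMC (admissibleHull S T ∩ midClique l k₀) (Finset.univ \ T)
      = arcCount arcMC (S ∩ midClique l k₀) (Finset.univ \ T) := by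
  rw [arcCount_arcMC_eq_sum, arcCount_arcMC_eq_sum]
  refine Finset.sum_congr rfl fun f _ => if_congr ?_ rfl rfl
  simp only [Finset.mem_inter, admissibleHull, midClique, Finset.mem_filter, Finset.mem_univ,
    true_and, Finset.mem_sdiff]
  tauto

/-- Every negative selection is dominated by an admissible one. -/
theorem hall_admissibleHull_le (P : MixedDecomposition c l) {R : Finset V}
    (S : Finset (Mid l k₀)) (T : Finset (Fin k₀)) (hR : R ⊆ c.uncolored) :
    hallRHS P ∅ (forcedInto P (admissibleHull S T)) ∅ (admissibleHull S T) ∅ T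
        - hallLHS c (forcedInto P (admissibleHull S T)) T
      ≤ hallRHS P ∅ R ∅ S ∅ T - hallLHS c R T := by
  rw [hallRHS_forcedInto P (admissible_admissibleHull S T), hallRHS_minus,
    arcCount_admissibleHull_midClique]
  have h1 := card_le_arcCount_add_card_forcedInto P (admissibleHull S T) hR
  have h2 := arcCount_admissibleHull_le P R S T
  zify at h1 h2
  simp only [hallLHS]
  linarith

theorem forall_hallIneq_iff_reducedCondition (P : MixedDecomposition c l) (T : Finset (Fin k₀)) :
    (∀ (R : Finset V) (S : Finset (Mid l k₀)), R ⊆ c.uncolored → HallIneq P ∅ R ∅ S ∅ T) ↔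
      ∀ S : Finset (Mid l k₀), Admissible S T → ReducedCondition P S T := by
  constructor
  · exact fun h S hS => (hallIneq_forcedInto_iff P hS).1 (h _ S (forcedInto_subset P S))
  · intro h R S hR
    have h1 := (hallIneq_forcedInto_iff P (admissible_admissibleHull S T)).2
      (h _ (admissible_admissibleHull S T))
    have h2 := hall_admissibleHull_le P S T hR
    unfold HallIneq at *
    linarith

/-- For `S = δ⁻(T)` no arc runs from `S` to `C \ T`, and a vertex is forced exactly when its free
colors lie in `T`, since it sees the copies of all of them in its own part. -/
theorem reducedCondition_inNbrs_iff (P : MixedDecomposition c l) (T : Finset (Fin k₀)) :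
    ReducedCondition P (inNbrs arcMC T) T ↔ PracticalCondition c T := by
  classical
  have h1 : forcedInto P (inNbrs arcMC T : Finset (Mid l k₀))
      = {v ∈ c.uncolored | ∀ i : Fin k₀, (i : ℕ) ∈ c.free v → i ∈ T} := by
    ext v
    rw [mem_forcedInto, Finset.mem_filter]
    refine and_congr_right fun hv => ?_
    simp only [mem_inNbrs_arcMC]
    constructor
    · intro h i hi
      obtain ⟨j, hj⟩ := (P.cover v).1 hv
      exact h (j, i) ⟨hj, hi⟩
    · exact fun h f hf => h f.2 hf.2
  have h2 : arcCount arcMC (inNbrs arcMC T ∩ midClique l k₀) (Finset.univ \ T) = 0 := by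
    refine arcCount_eq_zero fun f hf i hi h => (Finset.mem_sdiff.1 hi).2 ?_
    rw [← h]
    exact mem_inNbrs_arcMC.1 (Finset.mem_inter.1 hf).1
  have h3 : ∑ i ∈ T, (-upperSize V k₀ + ((c.cls i).card : ℤ))
      = -∑ i ∈ T, (upperSize V k₀ - ((c.cls i).card : ℤ)) := by
    rw [← Finset.sum_neg_distrib]
    exact Finset.sum_congr rfl fun i _ => by ring
  rw [ReducedCondition, PracticalCondition, h1, h2, h3, Nat.cast_zero, ← sub_eq_add_neg,
    sub_nonpos]

theorem flowSolvable_iff_reduced (P : MixedDecomposition c l) :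
    FlowSolvable P k₀ ↔
      (∀ (Rp Rm : Finset V) (Sp Sm : Finset (Mid l k₀)) (Tp : Finset (Fin k₀)),
        Compatible P Rp Rm Sp Sm Tp ∅ → HallIneq P Rp Rm Sp Sm Tp ∅) ∧
      (∀ (T : Finset (Fin k₀)) (S : Finset (Mid l k₀)),
        T.Nonempty → Admissible S T → ReducedCondition P S T) := by
  rw [flowSolvable_iff_hallIneq]
  constructor
  · rintro ⟨hm, hp⟩
    refine ⟨fun Rp Rm Sp Sm Tp hc => ?_, fun T S _ hS => ?_⟩
    · exact hallIneq_of_parts P (hm Rm Sm ∅ hc.2.1) (hp Rp Sp Tp hc.1)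
    · exact (forall_hallIneq_iff_reducedCondition P T).1 (fun R S hR => hm R S T hR) S hS
  · rintro ⟨h0, h1⟩
    refine ⟨fun R S T hR => ?_, fun R S T hR => ?_⟩
    · rcases T.eq_empty_or_nonempty with rfl | hT
      -- A negative inequality with `T = ∅` belongs to the first family; the selection is compatible
      -- because its positive sets are empty.
      · exact h0 ∅ R ∅ S ∅ (by simp [Compatible, hR, outNbrs])
      · exact (forall_hallIneq_iff_reducedCondition P T).2 (fun S hS => h1 T S hT hS) R S hR
    · exact h0 R ∅ S ∅ T (by simp [Compatible, hR, outNbrs])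

end Reduction

end EquitableFlow

open EquitableFlow in
theorem mainTheorem6 {V : Type*} [Fintype V] (G : SimpleGraph V) {k l k₀ : ℕ}
    (c : PartialColoring G k) (P : MixedDecomposition c l)
    (hk₀ : 0 < k₀) (hk : k ≤ k₀) (hn : k₀ ≤ Fintype.card V) :
    -- Among the Hall conditions with `T_- ≠ ∅`, the reduced family suffices for solvability.
    (FlowSolvable P k₀ ↔
      (∀ (Rp Rm : Finset V) (Sp Sm : Finset (Mid l k₀)) (Tp : Finset (Fin k₀)),
        Compatible P Rp Rm Sp Sm Tp ∅ → HallIneq P Rp Rm Sp Sm Tp ∅) ∧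
      (∀ (T : Finset (Fin k₀)) (S : Finset (Mid l k₀)),
        T.Nonempty → Admissible S T → ReducedCondition P S T)) ∧
    ∀ T : Finset (Fin k₀), T.Nonempty →
      -- Every choice of `R_-`, `S_-` is dominated by an admissible one.
      (∀ (R : Finset V) (S : Finset (Mid l k₀)), R ⊆ c.uncolored →
        ∃ S' : Finset (Mid l k₀), Admissible S' T ∧
          hallRHS P ∅ (forcedInto P S') ∅ S' ∅ T - hallLHS c (forcedInto P S') T
            ≤ hallRHS P ∅ R ∅ S ∅ T - hallLHS c R T) ∧
      -- For an admissible choice the Hall inequality is the reduced condition.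
      (∀ S : Finset (Mid l k₀), Admissible S T →
        hallRHS P ∅ (forcedInto P S) ∅ S ∅ T
            = (arcCount arcMC (S ∩ midClique l k₀) (Finset.univ \ T) : ℤ) ∧
        (HallIneq P ∅ (forcedInto P S) ∅ S ∅ T ↔ ReducedCondition P S T)) ∧
      ((∀ (R : Finset V) (S : Finset (Mid l k₀)), R ⊆ c.uncolored → HallIneq P ∅ R ∅ S ∅ T) ↔
        ∀ S : Finset (Mid l k₀), Admissible S T → ReducedCondition P S T) ∧
      -- The practical special case `S_- = δ⁻(T_-)`.
      Admissible (inNbrs arcMC T : Finset (Mid l k₀)) T ∧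
      (ReducedCondition P (inNbrs arcMC T) T ↔ PracticalCondition c T) ∧
      (FlowSolvable P k₀ → PracticalCondition c T) := by
  have hadm : ∀ T : Finset (Fin k₀), Admissible (inNbrs arcMC T : Finset (Mid l k₀)) T :=
    fun T => ⟨Finset.Subset.refl _, rfl⟩
  refine ⟨flowSolvable_iff_reduced P, fun T hT => ⟨?_, ?_, ?_, hadm T, ?_, ?_⟩⟩
  · exact fun R S hR => ⟨admissibleHull S T, admissible_admissibleHull S T,
      hall_admissibleHull_le P S T hR⟩
  · exact fun S hS => ⟨hallRHS_forcedInto P hS, hallIneq_forcedInto_iff P hS⟩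
  · exact forall_hallIneq_iff_reducedCondition P T
  · exact reducedCondition_inNbrs_iff P T
  · exact fun h => (reducedCondition_inNbrs_iff P T).1
      (((flowSolvable_iff_reduced P).1 h).2 T _ hT (hadm T))
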